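/- Let $H\in(0,\tfrac12)$, $x_0>0$, $a>0$, $\sigma>0$, and let $B^H=\{B^H(t),\ t\ge 0\}$ be a fractional Brownian motion with Hurst index $H$ and continuous sample paths, i.e. a centered Gaussian process with $\mathbb E[B^H(s)B^H(t)]=\tfrac12\left(s^{2H}+t^{2H}-|t-s|^{2H}\right)$. For each $\varepsilon>0$ let $X^H_\varepsilon=\{X^H_\varepsilon(t),\ t\ge0\}$ be the continuous process solving, pathwise, $$X^H_\varepsilon(t)=x_0+\int_0^t\frac{a}{X^H_\varepsilon(s)\mathbf 1_{\{X^H_\varepsilon(s)>0\}}+\varepsilon}\,ds+\sigma B^H(t),\qquad t\ge 0$$ (almost surely for all $\varepsilon>0$ simultaneously), and let $X^H(t):=\lim_{\varepsilon\downarrow0}X^H_\varepsilon(t)$, $t\ge0$, be the rough Bessel process. Then for every $T>0$, almost surely, $$\sup_{t\in[0,T]}\left|X^H(t)-X^H_\varepsilon(t)\right|\to 0\qquad\text{as }\varepsilon\downarrow0 .$$ In particular, almost surely the limit defining $X^H(t)$ exists and is finite for every $t\in[0,T]$. -/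

import Mathlib

open MeasureTheory ProbabilityTheory Filter Topology
open scoped NNReal ENNReal

/-- A fractional Brownian motion with Hurst index `H` and continuous sample paths: a centered
Gaussian process on `[0, ∞)` with the covariance function
`(s ^ (2H) + t ^ (2H) - |t - s| ^ (2H)) / 2`. -/
structure IsFractionalBrownianMotion {Ω : Type*} {mΩ : MeasurableSpace Ω}
    (H : ℝ) (B : ℝ≥0 → Ω → ℝ) (P : Measure Ω) : Prop where
  isGaussianProcess : IsGaussianProcess B P
  centered : ∀ t, ∫ ω, B t ω ∂P = 0
  covariance_eq : ∀ s t, ∫ ω, B s ω * B t ω ∂P =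
    ((s : ℝ) ^ (2 * H) + (t : ℝ) ^ (2 * H) - |(t : ℝ) - (s : ℝ)| ^ (2 * H)) / 2
  cont : ∀ᵐ ω ∂P, Continuous fun t ↦ B t ω

/-- The drift `a / (y 𝟙_{y > 0} + ε)` of the pre-limit equation. -/
noncomputable def preLimitDrift (a ε y : ℝ) : ℝ :=
  a / (y * (Set.Ioi (0 : ℝ)).indicator 1 y + ε)

/-- The continuous path `x` solves the pre-limit equation driven by the path `β`:
`x(t) = x₀ + ∫₀ᵗ a / (x(s) 𝟙_{x(s) > 0} + ε) ds + σ β(t)` for all `t ≥ 0`. -/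
structure IsPreLimitSolution (x₀ a σ ε : ℝ) (β x : ℝ≥0 → ℝ) : Prop where
  cont : Continuous x
  eq : ∀ t : ℝ≥0, x t =
    x₀ + (∫ s in (0 : ℝ)..(t : ℝ), preLimitDrift a ε (x s.toNNReal)) + σ * β t

/-- The rough Bessel process: the pointwise limit, as `ε ↓ 0`, of the family
`X ε t ω = X_ε(t)(ω)` of pre-limit processes. -/
noncomputable def roughBessel {Ω : Type*} (X : ℝ → ℝ≥0 → Ω → ℝ) (t : ℝ≥0) (ω : Ω) : ℝ :=
  limUnder (𝓝[>] (0 : ℝ)) fun ε ↦ X ε t ω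

/-! The argument is pathwise. The drift `a / (max y 0 + ε)` is nonincreasing in `y`, and the common
noise cancels in the difference of two solutions, so a gap wider than `δ` cannot grow once the lower
path stays above `-δ/2` and its own parameter is at most `δ/2` (`sub_le`). That lower bound holds
for small `ε`: below zero the drift is `a/ε`, which outweighs any noise on a compact interval
(`eventually_neg_le`). The family is thus uniformly Cauchy. -/

/-- The last time before `t` at which a continuous function does not exceed the level `c`. -/
theorem exists_last_le_of_lt {h : ℝ≥0 → ℝ} (hh : Continuous h) {c : ℝ} (h0 : h 0 ≤ c)
    {t : ℝ≥0} (ht : c < h t) :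
    ∃ u < t, h u ≤ c ∧ ∀ s, u < s → s ≤ t → c < h s := by
  have hK : IsCompact (Set.Icc 0 t ∩ {s | h s ≤ c}) :=
    isCompact_Icc.inter_right (isClosed_le hh continuous_const)
  obtain ⟨u, ⟨hu, huc⟩, hmax⟩ := hK.exists_isGreatest ⟨0, ⟨le_rfl, zero_le⟩, h0⟩
  refine ⟨u, lt_of_le_of_ne hu.2 ?_, huc, fun s hus hst ↦ ?_⟩
  · rintro rfl
    exact absurd huc (not_le.2 ht)
  · by_contra! hs
    exact absurd (hmax ⟨⟨zero_le, hst⟩, hs⟩) (not_le.2 hus)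

theorem preLimitDrift_eq_max (a ε y : ℝ) : preLimitDrift a ε y = a / (max y 0 + ε) := by
  unfold preLimitDrift
  rcases lt_or_ge 0 y with hy | hy
  · rw [Set.indicator_of_mem (Set.mem_Ioi.2 hy), max_eq_left hy.le, Pi.one_apply, mul_one]
  · rw [Set.indicator_of_notMem (by simpa using hy), max_eq_right hy, mul_zero]

theorem max_zero_add_pos {ε : ℝ} (hε : 0 < ε) (y : ℝ) : 0 < max y 0 + ε :=
  add_pos_of_nonneg_of_pos (le_max_right _ _) hε

theorem continuous_preLimitDrift (a : ℝ) {ε : ℝ} (hε : 0 < ε) :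
    Continuous (preLimitDrift a ε) := by
  simp_rw [funext (preLimitDrift_eq_max a ε)]
  exact continuous_const.div (by fun_prop) fun y ↦ (max_zero_add_pos hε y).ne'

namespace IsPreLimitSolution

variable {x₀ a σ ε : ℝ} {β x : ℝ≥0 → ℝ}

theorem continuous_drift (hx : IsPreLimitSolution x₀ a σ ε β x) (hε : 0 < ε) :
    Continuous fun s : ℝ ↦ preLimitDrift a ε (x s.toNNReal) :=
  (continuous_preLimitDrift a hε).comp (hx.cont.comp continuous_real_toNNReal)

theorem apply_zero (hx : IsPreLimitSolution x₀ a σ ε β x) : x 0 = x₀ + σ * β 0 := by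
  simpa using hx.eq 0

theorem sub_eq (hx : IsPreLimitSolution x₀ a σ ε β x) (hε : 0 < ε) (u t : ℝ≥0) :
    x t - x u = (∫ s in (u : ℝ)..(t : ℝ), preLimitDrift a ε (x s.toNNReal))
      + σ * (β t - β u) := by
  have hc := hx.continuous_drift hε
  rw [← intervalIntegral.integral_interval_sub_left (hc.intervalIntegrable 0 t)
    (hc.intervalIntegrable 0 u), hx.eq t, hx.eq u]
  ring

/-- For small `ε` the solutions are uniformly almost nonnegative on compact intervals. -/
theorem eventually_neg_le (ha : 0 < a) (hσ : 0 < σ) (hβ : Continuous β)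
    (h0 : 0 ≤ x₀ + σ * β 0) (T : ℝ≥0) {δ : ℝ} (hδ : 0 < δ) :
    ∃ ε₀ > 0, ∀ ε x, 0 < ε → ε ≤ ε₀ → IsPreLimitSolution x₀ a σ ε β x →
      ∀ t ≤ T, -δ ≤ x t := by
  have hK : IsCompact (Set.Icc (0 : ℝ≥0) T) := isCompact_Icc
  obtain ⟨M, hM⟩ := hK.exists_bound_of_continuousOn hβ.continuousOn
  obtain ⟨η, hη, hβη⟩ := Metric.uniformContinuousOn_iff.1
    (hK.uniformContinuousOn_of_continuous hβ.continuousOn) (δ / 2 / σ) (by positivity)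
  have hM0 : 0 ≤ M := (norm_nonneg _).trans (hM 0 ⟨le_rfl, zero_le⟩)
  -- Over a time `η` the drift `a/ε` then contributes at least `2σM + 1`, more than the noise can
  -- take away.
  refine ⟨a * η / (2 * σ * M + 1), by positivity, fun ε x hε hεle hx t htT ↦ ?_⟩
  by_contra! hlt
  obtain ⟨u, hut, hu, hgt⟩ := exists_last_le_of_lt (h := fun s ↦ -x s) hx.cont.neg
    (c := δ / 2) (by simp only [hx.apply_zero]; linarith) (t := t) (by linarith)
  have hut' : (u : ℝ) < t := by exact_mod_cast hut
  have hint : (∫ s in (u : ℝ)..(t : ℝ), preLimitDrift a ε (x s.toNNReal))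
      = (t - u) * (a / ε) := by
    rw [← smul_eq_mul, ← intervalIntegral.integral_const]
    refine intervalIntegral.integral_congr_ae (Eventually.of_forall fun s hs ↦ ?_)
    rw [Set.uIoc_of_le hut'.le] at hs
    have := hgt s.toNNReal (Real.lt_toNNReal_iff_coe_lt.2 hs.1) (Real.toNNReal_le_iff_le_coe.2 hs.2)
    rw [preLimitDrift_eq_max, max_eq_right (by linarith), zero_add]
  have hsub := hx.sub_eq hε u t
  rw [hint] at hsub
  have huK : u ∈ Set.Icc 0 T := ⟨zero_le, hut.le.trans htT⟩
  have htK : t ∈ Set.Icc 0 T := ⟨zero_le, htT⟩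
  have hpos : 0 ≤ (t - u : ℝ) * (a / ε) :=
    mul_nonneg (sub_nonneg.2 hut'.le) (by positivity)
  -- The path falls by more than `δ/2` while the drift pushes up, so the noise alone must fall that
  -- much, which takes time at least `η`.
  have hfar : η ≤ (t - u : ℝ) := by
    by_contra! hnear
    have hd : dist u t < η := by
      rw [NNReal.dist_eq, abs_sub_comm, abs_of_pos (sub_pos.2 hut')]
      exact hnear
    have hlt' := hβη u huK t htK hd
    rw [Real.dist_eq, lt_div_iff₀ hσ] at hlt'
    have := mul_le_mul_of_nonneg_right (le_abs_self (β u - β t)) hσ.le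
    linarith
  have hfast : 2 * σ * M + 1 ≤ η * (a / ε) := by
    rw [le_div_iff₀ (by positivity)] at hεle
    rw [← mul_div_assoc, le_div_iff₀ hε]
    linarith
  have hge : η * (a / ε) ≤ (t - u : ℝ) * (a / ε) :=
    mul_le_mul_of_nonneg_right hfar (by positivity)
  have hb1 := neg_le_of_abs_le (hM t htK)
  have hb2 := le_of_abs_le (hM u huK)
  have hb : σ * (-(2 * M)) ≤ σ * (β t - β u) :=
    mul_le_mul_of_nonneg_left (by linarith) hσ.le
  linarith

/-- Two solutions, driven by the same path, that are almost nonnegative are close. -/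
theorem sub_le {ε' δ : ℝ} {y : ℝ≥0 → ℝ} (hx : IsPreLimitSolution x₀ a σ ε β x)
    (hy : IsPreLimitSolution x₀ a σ ε' β y) (ha : 0 < a) (hε : 0 < ε) (hε' : 0 < ε')
    (hδ : 0 < δ) (hε'δ : ε' ≤ δ / 2) {T : ℝ≥0} (hyT : ∀ t ≤ T, -(δ / 2) ≤ y t)
    {t : ℝ≥0} (ht : t ≤ T) : x t - y t ≤ δ := by
  by_contra! hlt
  obtain ⟨u, hut, hu, hgt⟩ := exists_last_le_of_lt (h := fun s ↦ x s - y s)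
    (hx.cont.sub hy.cont) (c := δ)
    (by simp only [hx.apply_zero, hy.apply_zero, sub_self]; exact hδ.le) hlt
  have hut' : (u : ℝ) ≤ t := by exact_mod_cast hut.le
  have hint : (∫ s in (u : ℝ)..(t : ℝ), preLimitDrift a ε (x s.toNNReal))
      ≤ ∫ s in (u : ℝ)..(t : ℝ), preLimitDrift a ε' (y s.toNNReal) := by
    refine intervalIntegral.integral_mono_on_of_le_Ioo hut'
      ((hx.continuous_drift hε).intervalIntegrable _ _)
      ((hy.continuous_drift hε').intervalIntegrable _ _) fun s hs ↦ ?_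
    have hst : s.toNNReal ≤ t := Real.toNNReal_le_iff_le_coe.2 hs.2.le
    have h1 := hgt s.toNNReal (Real.lt_toNNReal_iff_coe_lt.2 hs.1) hst
    have h2 := hyT s.toNNReal (hst.trans ht)
    rw [preLimitDrift_eq_max, preLimitDrift_eq_max]
    refine div_le_div_of_nonneg_left ha.le (max_zero_add_pos hε' _) ?_
    -- Hence `max y 0 + ε' ≤ y + δ < x`, which compares the denominators.
    have h3 : max (y s.toNNReal) 0 ≤ y s.toNNReal + δ / 2 :=
      max_le (by linarith) (by linarith)
    have h4 := le_max_left (x s.toNNReal) 0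
    linarith
  have h1 := hx.sub_eq hε u t
  have h2 := hy.sub_eq hε' u t
  linarith

end IsPreLimitSolution

/-- Solutions of the pre-limit equation driven by the same continuous path form a uniformly Cauchy
family on compact intervals. -/
theorem exists_abs_sub_le_of_isPreLimitSolution {x₀ a σ : ℝ} {β : ℝ≥0 → ℝ} {x : ℝ → ℝ≥0 → ℝ}
    (ha : 0 < a) (hσ : 0 < σ) (hβ : Continuous β) (h0 : 0 ≤ x₀ + σ * β 0)
    (hx : ∀ ε, 0 < ε → IsPreLimitSolution x₀ a σ ε β (x ε)) (T : ℝ≥0) {δ : ℝ} (hδ : 0 < δ) :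
    ∃ ε₀ > 0, ∀ ε ∈ Set.Ioc 0 ε₀, ∀ ε' ∈ Set.Ioc 0 ε₀, ∀ t ≤ T, |x ε t - x ε' t| ≤ δ := by
  obtain ⟨ε₀, hε₀, hlow⟩ :=
    IsPreLimitSolution.eventually_neg_le ha hσ hβ h0 T (half_pos hδ)
  refine ⟨min ε₀ (δ / 2), lt_min hε₀ (half_pos hδ), fun ε hε ε' hε' t ht ↦ ?_⟩
  have key : ∀ ε ∈ Set.Ioc 0 (min ε₀ (δ / 2)), ∀ ε' ∈ Set.Ioc 0 (min ε₀ (δ / 2)),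
      x ε t - x ε' t ≤ δ := fun ε hε ε' hε' ↦
    (hx ε hε.1).sub_le (hx ε' hε'.1) ha hε.1 hε'.1 hδ (hε'.2.trans (min_le_right _ _))
      (hlow ε' _ hε'.1 (hε'.2.trans (min_le_left _ _)) (hx ε' hε'.1)) ht
  have := key ε' hε' ε hε
  exact abs_le.2 ⟨by linarith, key ε hε ε' hε'⟩

/-- A uniformly Cauchy family of real functions converges pointwise to its limit. -/
theorem tendsto_limUnder_of_exists_abs_sub_le {f : ℝ → ℝ}
    (hf : ∀ δ > 0, ∃ ε₀ > 0, ∀ ε ∈ Set.Ioc 0 ε₀, ∀ ε' ∈ Set.Ioc 0 ε₀, |f ε - f ε'| ≤ δ) :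
    Tendsto f (𝓝[>] 0) (𝓝 (limUnder (𝓝[>] 0) f)) := by
  refine tendsto_nhds_limUnder (cauchy_map_iff_exists_tendsto.1 (Metric.cauchy_iff.2
    ⟨inferInstance, fun δ hδ ↦ ?_⟩))
  obtain ⟨ε₀, hε₀, h⟩ := hf (δ / 2) (half_pos hδ)
  refine ⟨f '' Set.Ioc 0 ε₀, image_mem_map (Ioc_mem_nhdsGT hε₀), ?_⟩
  rintro _ ⟨ε, hε, rfl⟩ _ ⟨ε', hε', rfl⟩
  exact (h ε hε ε' hε').trans_lt (half_lt_self hδ)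

theorem IsFractionalBrownianMotion.ae_apply_zero {Ω : Type*} {mΩ : MeasurableSpace Ω}
    {P : Measure Ω} {H : ℝ} (hH₀ : 0 < H) {B : ℝ≥0 → Ω → ℝ}
    (hB : IsFractionalBrownianMotion H B P) : ∀ᵐ ω ∂P, B 0 ω = 0 := by
  have hL : MemLp (B 0) 2 P := (hB.isGaussianProcess.hasGaussianLaw_eval 0).memLp_two
  have h0 : ∫ ω, B 0 ω * B 0 ω ∂P = 0 := by
    rw [hB.covariance_eq 0 0]
    simp [Real.zero_rpow (mul_pos two_pos hH₀).ne']
  -- Without integrability the zero integral could be the default value.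
  have hint : Integrable (fun ω ↦ B 0 ω * B 0 ω) P := hL.integrable_mul hL
  filter_upwards [(integral_eq_zero_iff_of_nonneg (fun ω ↦ mul_self_nonneg (B 0 ω)) hint).1 h0]
    with ω hω
  exact mul_self_eq_zero.1 hω

theorem mainTheorem7 {Ω : Type*} {mΩ : MeasurableSpace Ω} (P : Measure Ω) [IsProbabilityMeasure P]
    (H : ℝ) (hH₀ : 0 < H) (hH : H < 1 / 2)
    (x₀ a σ : ℝ) (hx₀ : 0 < x₀) (ha : 0 < a) (hσ : 0 < σ)
    (B : ℝ≥0 → Ω → ℝ) (hB : IsFractionalBrownianMotion H B P)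
    (X : ℝ → ℝ≥0 → Ω → ℝ)
    (hX : ∀ᵐ ω ∂P, ∀ ε : ℝ, 0 < ε →
      IsPreLimitSolution x₀ a σ ε (fun t ↦ B t ω) (fun t ↦ X ε t ω))
    (T : ℝ≥0) (hT : 0 < T) :
    ∀ᵐ ω ∂P, Tendsto
      (fun ε : ℝ ↦ ⨆ t ∈ Set.Icc (0 : ℝ≥0) T, ENNReal.ofReal |roughBessel X t ω - X ε t ω|)
      (𝓝[>] 0) (𝓝 0) := by
  filter_upwards [hX, hB.cont, hB.ae_apply_zero hH₀] with ω hXω hBω hB0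
  have hC := fun δ (hδ : (0 : ℝ) < δ) ↦ exists_abs_sub_le_of_isPreLimitSolution
    (x := fun ε t ↦ X ε t ω) ha hσ hBω (by simp [hB0, hx₀.le]) hXω T hδ
  have hlim : ∀ t ≤ T, Tendsto (fun ε ↦ X ε t ω) (𝓝[>] 0) (𝓝 (roughBessel X t ω)) := by
    refine fun t ht ↦ tendsto_limUnder_of_exists_abs_sub_le fun δ hδ ↦ ?_
    obtain ⟨ε₀, hε₀, h⟩ := hC δ hδ
    exact ⟨ε₀, hε₀, fun ε hε ε' hε' ↦ h ε hε ε' hε' t ht⟩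
  refine ENNReal.tendsto_nhds_zero.2 fun r hr ↦ ?_
  obtain ⟨δ, hδ, hδr⟩ : ∃ δ : ℝ, 0 < δ ∧ ENNReal.ofReal δ ≤ r := by
    obtain ⟨δ, hδ, hδr⟩ := ENNReal.lt_iff_exists_nnreal_btwn.1 hr
    exact ⟨δ, by exact_mod_cast hδ, by simpa using hδr.le⟩
  obtain ⟨ε₀, hε₀, h⟩ := hC δ hδ
  filter_upwards [Ioc_mem_nhdsGT hε₀] with ε hε
  refine iSup₂_le fun t ht ↦ (ENNReal.ofReal_le_ofReal ?_).trans hδr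
  -- Let `ε' ↓ 0` in the Cauchy bound with `ε` fixed; the bound is uniform in `t`.
  refine le_of_tendsto ((hlim t ht.2).sub_const (X ε t ω)).abs ?_
  filter_upwards [Ioc_mem_nhdsGT hε₀] with ε' hε'
  exact h ε' hε' ε hε t ht.2
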